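/- Let $\mathcal N=SL_2(\mathbb R[z,z^{-1}])$. Let $\mathcal D=\{\mathbf D_K=\mathrm{diag}(1/K,K): K\in\mathbb R\setminus\{0\}\}$, let $\mathcal P_a=\{S\in\mathbb R[z,z^{-1}]: S(z^{-1})=-S(z)\}$ be the group of whole-sample antisymmetric (WA) filters, and let $$\mathcal U=\left\{\begin{bmatrix}1&S\\0&1\end{bmatrix}: S\in\mathcal P_a\right\},\qquad \mathcal L=\left\{\begin{bmatrix}1&0\\S&1\end{bmatrix}: S\in\mathcal P_a\right\}$$ be the WA lifting matrix groups. Let $\mathcal C_{\mathfrak H}=\langle\mathcal U\cup\mathcal L\rangle$ be the lifting cascade group and $\mathcal S_{\mathfrak H}=\langle\mathcal D\cup\mathcal C_{\mathfrak H}\rangle$ the scaled lifting group. The unimodular half-sample symmetric (HS) class is $$\mathfrak H=\left\{\mathbf H\in\mathcal N:\ \mathbf H(z^{-1})=\begin{bmatrix}1&0\\0&-1\end{bmatrix}\mathbf H(z)\begin{bmatrix}0&1\\1&0\end{bmatrix}\right\}.$$ For $\mathbf H\in\mathcal N$ and $i=0,1$ let $H_i(z)=H_{i0}(z^2)+z\,H_{i1}(z^2)$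 be its scalar filters, and let the order of a nonzero Laurent polynomial be the difference of its highest and lowest exponents. Put $$\mathfrak B_{\mathfrak H}=\{\mathbf B\in\mathfrak H:\ \mathrm{order}(B_0)=\mathrm{order}(B_1)\},\qquad \mathfrak B'_{\mathfrak H}=\{\mathbf B\in\mathfrak B_{\mathfrak H}:\ B_0(1)=1\}.$$ 1. There is an isomorphism $\rho:\mathcal C_{\mathfrak H}\to\mathcal U*\mathcal L$ onto the free product that restricts to the canonical inclusions on $\mathcal U$ and $\mathcal L$. Let $\theta:\mathcal D\to\mathrm{Aut}(\mathcal U*\mathcal L)$ be the action by conjugation of each letter; then $\theta_{\mathbf D}=\rho\circ\gamma_{\mathbf D}\circ\rho^{-1}$ for every $\mathbf D\in\mathcal D$, where $\gamma_{\mathbf D}\mathbf E=\mathbf D\mathbf E\mathbf D^{-1}$ for $\mathbf E\in\mathcal C_{\mathfrak H}$, and $$\mathcal S_{\mathfrak H}\cong\mathcal D\ltimes_\theta(\mathcal U*\mathcal L)$$ through an isomorphism that sends $\mathbf D\mathbf E$ to the product of the images of $\mathbf D$ and $\rho(\mathbf E)$ in the semidirect product, for all $\mathbf D\in\mathcal D$,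 $\mathbf E\in\mathcal C_{\mathfrak H}$. 2. $\mathfrak H=\bigcup\{\mathcal C_{\mathfrak H}\mathbf B:\mathbf B\in\mathfrak B_{\mathfrak H}\}$, and the right cosets $\mathcal C_{\mathfrak H}\mathbf B$ for distinct $\mathbf B\in\mathfrak B_{\mathfrak H}$ are disjoint. 3. $\mathfrak H=\bigcup\{\mathcal S_{\mathfrak H}\mathbf B:\mathbf B\in\mathfrak B'_{\mathfrak H}\}$, and the right cosets $\mathcal S_{\mathfrak H}\mathbf B$ for distinct $\mathbf B\in\mathfrak B'_{\mathfrak H}$ are disjoint. 4. $\mathfrak H$ is not a union of left cosets $\mathbf A\,\mathcal C_{\mathfrak H}$ ($\mathbf A\in\mathcal N$), and it is not a union of left cosets $\mathbf A\,\mathcal S_{\mathfrak H}$ ($\mathbf A\in\mathcal N$). -/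

import Mathlib

open scoped LaurentPolynomial Pointwise

noncomputable section

namespace HSBank

/-- The unimodular group: `2 × 2` matrices of determinant `1` over `ℝ[z, z⁻¹]` (with `z = T 1`). -/
abbrev Unimod : Type := Matrix.SpecialLinearGroup (Fin 2) ℝ[T;T⁻¹]

/-- The gain-scaling matrix `D_K = diag(1/K, K)`, as a homomorphism in `K ∈ ℝ \ {0}`. -/
def gain : ℝˣ →* Unimod where
  toFun K := ⟨!![LaurentPolynomial.C ((K : ℝ)⁻¹), 0; 0, LaurentPolynomial.C (K : ℝ)], by
    rw [Matrix.det_fin_two_of, ← map_mul]; simp⟩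
  map_one' := by
    ext i j; fin_cases i <;> fin_cases j <;> simp
  map_mul' K K' := by
    apply Subtype.ext
    change _ = !![LaurentPolynomial.C ((K : ℝ)⁻¹), 0; 0, LaurentPolynomial.C (K : ℝ)] *
      !![LaurentPolynomial.C ((K' : ℝ)⁻¹), 0; 0, LaurentPolynomial.C (K' : ℝ)]
    simp [mul_comm]

/-- The upper triangular lifting matrix with lifting filter `S`. -/
def upsilon : Multiplicative ℝ[T;T⁻¹] →* Unimod where
  toFun S := ⟨!![1, S.toAdd; 0, 1], by simp [Matrix.det_fin_two_of]⟩
  map_one' := by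
    ext i j; fin_cases i <;> fin_cases j <;> simp
  map_mul' S S' := by
    apply Subtype.ext
    change _ = !![1, S.toAdd; 0, 1] * !![1, S'.toAdd; 0, 1]
    simp [add_comm]

/-- The lower triangular lifting matrix with lifting filter `S`. -/
def lambda : Multiplicative ℝ[T;T⁻¹] →* Unimod where
  toFun S := ⟨!![1, 0; S.toAdd, 1], by simp [Matrix.det_fin_two_of]⟩
  map_one' := by
    ext i j; fin_cases i <;> fin_cases j <;> simp
  map_mul' S S' := by
    apply Subtype.ext
    change _ = !![1, 0; S.toAdd, 1] * !![1, 0; S'.toAdd, 1]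
    simp

/-- Whole-sample antisymmetric (WA) filters: `S(z⁻¹) = -S(z)`. -/
def WA : AddSubgroup ℝ[T;T⁻¹] where
  carrier := {S | LaurentPolynomial.invert S = -S}
  zero_mem' := by simp
  add_mem' {a b} ha hb := by
    simp only [Set.mem_ofPred_eq] at *
    rw [map_add, ha, hb, neg_add]
  neg_mem' {a} ha := by
    simp only [Set.mem_ofPred_eq] at *
    rw [map_neg, ha]

/-- The group `𝒟` of all gain-scaling matrices. -/
def D : Subgroup Unimod := gain.range

/-- The group `𝒰` of upper triangular WA lifting matrices. -/
def U : Subgroup Unimod := (AddSubgroup.toSubgroup WA).map upsilon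

/-- The group `ℒ` of lower triangular WA lifting matrices. -/
def L : Subgroup Unimod := (AddSubgroup.toSubgroup WA).map lambda

/-- The lifting cascade group `𝒞 = ⟨𝒰 ∪ ℒ⟩`. -/
def Cas : Subgroup Unimod := Subgroup.closure ((U : Set Unimod) ∪ (L : Set Unimod))

/-- The scaled lifting group `𝒮 = ⟨𝒟 ∪ 𝒞⟩`. -/
def Sca : Subgroup Unimod := Subgroup.closure ((D : Set Unimod) ∪ (Cas : Set Unimod))

/-- The unimodular HS class `𝔥`: `H(z⁻¹) = diag(1, -1) H(z) J`, `J` the exchange matrix. -/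
def HS : Set Unimod :=
  {H | (H : Matrix (Fin 2) (Fin 2) ℝ[T;T⁻¹]).map LaurentPolynomial.invert =
    !![1, 0; 0, -1] * (H : Matrix (Fin 2) (Fin 2) ℝ[T;T⁻¹]) * !![0, 1; 1, 0]}

/-- The substitution `f(z) ↦ f(z²)`. -/
def substSq : ℝ[T;T⁻¹] →+* ℝ[T;T⁻¹] :=
  AddMonoidAlgebra.mapDomainRingHom ℝ (AddMonoidHom.mulLeft (2 : ℤ))

/-- The scalar filter with polyphase-with-advance components `H i 0`, `H i 1`:
`H_i(z) = H_{i0}(z²) + z H_{i1}(z²)`. -/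
def filt (H : Unimod) (i : Fin 2) : ℝ[T;T⁻¹] :=
  substSq (H.1 i 0) + LaurentPolynomial.T 1 * substSq (H.1 i 1)

open Classical in
/-- The order `b - a` of a filter whose lowest and highest exponents are `a` and `b`
(set to `0` for the zero filter, which is never a row of an invertible matrix). -/
def order (f : ℝ[T;T⁻¹]) : ℤ :=
  if h : f.coeff.support.Nonempty then f.coeff.support.max' h - f.coeff.support.min' h else 0

/-- Equal-length HS base filter banks. -/
def Base : Set Unimod := {B | B ∈ HS ∧ order (filt B 0) = order (filt B 1)}

/-- Base filter banks normalized by `B₀(1) = 1`. -/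
def NormBase : Set Unimod :=
  {B | B ∈ Base ∧ LaurentPolynomial.eval₂ (RingHom.id ℝ) (1 : ℝˣ) (filt B 0) = 1}

theorem conj_upsilon (K : ℝˣ) (S : ℝ[T;T⁻¹]) :
    gain K * upsilon (.ofAdd S) * (gain K)⁻¹ =
      upsilon (.ofAdd (((K : ℝ)⁻¹ * (K : ℝ)⁻¹) • S)) := by
  rw [mul_inv_eq_iff_eq_mul]
  apply Subtype.ext
  have h : LaurentPolynomial.C ((K : ℝ)⁻¹) * LaurentPolynomial.C (K : ℝ) = 1 := by
    rw [← map_mul]; simp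
  change !![LaurentPolynomial.C ((K : ℝ)⁻¹), 0; 0, LaurentPolynomial.C (K : ℝ)] * !![1, S; 0, 1] =
    !![1, ((K : ℝ)⁻¹ * (K : ℝ)⁻¹) • S; 0, 1] *
      !![LaurentPolynomial.C ((K : ℝ)⁻¹), 0; 0, LaurentPolynomial.C (K : ℝ)]
  simp only [LaurentPolynomial.smul_eq_C_mul, map_mul, Matrix.mul_fin_two, mul_zero, zero_mul,
    add_zero, zero_add, mul_one, one_mul]
  rw [show LaurentPolynomial.C ((K : ℝ)⁻¹) * S = LaurentPolynomial.C ((K : ℝ)⁻¹) *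
    LaurentPolynomial.C ((K : ℝ)⁻¹) * S * LaurentPolynomial.C (K : ℝ) by
      linear_combination (-LaurentPolynomial.C ((K : ℝ)⁻¹) * S) * h]

theorem conj_lambda (K : ℝˣ) (S : ℝ[T;T⁻¹]) :
    gain K * lambda (.ofAdd S) * (gain K)⁻¹ =
      lambda (.ofAdd ((K * K : ℝ) • S)) := by
  rw [mul_inv_eq_iff_eq_mul]
  apply Subtype.ext
  have h : LaurentPolynomial.C ((K : ℝ)⁻¹) * LaurentPolynomial.C (K : ℝ) = 1 := by
    rw [← map_mul]; simp
  change !![LaurentPolynomial.C ((K : ℝ)⁻¹), 0; 0, LaurentPolynomial.C (K : ℝ)] * !![1, 0; S, 1] =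
    !![1, 0; (K * K : ℝ) • S, 1] *
      !![LaurentPolynomial.C ((K : ℝ)⁻¹), 0; 0, LaurentPolynomial.C (K : ℝ)]
  simp only [LaurentPolynomial.smul_eq_C_mul, map_mul, Matrix.mul_fin_two, mul_zero, zero_mul,
    add_zero, zero_add, mul_one, one_mul]
  rw [show LaurentPolynomial.C (K : ℝ) * S = LaurentPolynomial.C (K : ℝ) *
    LaurentPolynomial.C (K : ℝ) * S * LaurentPolynomial.C ((K : ℝ)⁻¹) by
      linear_combination (-LaurentPolynomial.C (K : ℝ) * S) * h]

theorem smul_mem_WA (r : ℝ) {S : ℝ[T;T⁻¹]} (hS : S ∈ WA) : r • S ∈ WA := by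
  change LaurentPolynomial.invert (r • S) = -(r • S)
  have : LaurentPolynomial.invert S = -S := hS
  rw [map_smul, this, smul_neg]

theorem le_normalizer_of_conj {G : Type*} [Group G] (Q M : Subgroup G)
    (h : ∀ q ∈ Q, ∀ m ∈ M, q * m * q⁻¹ ∈ M) : Q ≤ Subgroup.normalizer (M : Set G) := by
  intro q hq
  rw [Subgroup.mem_normalizer_iff]
  refine fun m => ⟨fun hm => h q hq m hm, fun hm => ?_⟩
  have := h q⁻¹ (Q.inv_mem hq) _ hm
  simpa [mul_assoc] using this

theorem D_le_normalizer_U : D ≤ Subgroup.normalizer (U : Set Unimod) := by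
  refine le_normalizer_of_conj _ _ ?_
  rintro _ ⟨K, rfl⟩ _ ⟨S, hS, rfl⟩
  exact ⟨_, smul_mem_WA ((K : ℝ)⁻¹ * (K : ℝ)⁻¹) (S := S.toAdd) hS, (conj_upsilon K S.toAdd).symm⟩

theorem D_le_normalizer_L : D ≤ Subgroup.normalizer (L : Set Unimod) := by
  refine le_normalizer_of_conj _ _ ?_
  rintro _ ⟨K, rfl⟩ _ ⟨S, hS, rfl⟩
  exact ⟨_, smul_mem_WA (K * K : ℝ) (S := S.toAdd) hS, (conj_lambda K S.toAdd).symm⟩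

theorem D_le_normalizer_Cas : D ≤ Subgroup.normalizer (Cas : Set Unimod) := by
  refine le_normalizer_of_conj _ _ fun q hq m hm => ?_
  have hle : Cas ≤ Cas.comap (MulAut.conj q).toMonoidHom := by
    refine (Subgroup.closure_le _).2 ?_
    rintro x (hx | hx)
    · exact Subgroup.subset_closure
        (Or.inl ((Subgroup.mem_normalizer_iff.1 (D_le_normalizer_U hq) x).1 hx))
    · exact Subgroup.subset_closure
        (Or.inr ((Subgroup.mem_normalizer_iff.1 (D_le_normalizer_L hq) x).1 hx))
  exact hle hm

/-- The action of `𝒟` by conjugation on a subgroup `M` that it normalizes. -/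
def gamma (M : Subgroup Unimod) (h : D ≤ Subgroup.normalizer (M : Set Unimod)) :
    D →* MulAut M :=
  M.normalizerMonoidHom.comp (Subgroup.inclusion h)

/-- The letterwise action on a free product induced by actions on its two factors. -/
def coprodAct {G A B : Type*} [Group G] [Group A] [Group B] (f : G →* MulAut A)
    (g : G →* MulAut B) : G →* MulAut (Monoid.Coprod A B) where
  toFun q := MulEquiv.coprodCongr (f q) (g q)
  map_one' := by
    rw [map_one, map_one]
    exact MulEquiv.toMonoidHom_injective (Monoid.Coprod.hom_ext rfl rfl)
  map_mul' q q' := by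
    rw [map_mul, map_mul]
    exact MulEquiv.toMonoidHom_injective (Monoid.Coprod.hom_ext rfl rfl)

/-- The action `θ` of `𝒟` on the free product `𝒰 ∗ ℒ`: conjugation of each letter. -/
def theta : D →* MulAut (Monoid.Coprod U L) :=
  coprodAct (gamma U D_le_normalizer_U) (gamma L D_le_normalizer_L)

theorem U_le_Cas : U ≤ Cas := fun _ h => Subgroup.subset_closure (Or.inl h)

theorem L_le_Cas : L ≤ Cas := fun _ h => Subgroup.subset_closure (Or.inr h)

theorem D_le_Sca : D ≤ Sca := fun _ h => Subgroup.subset_closure (Or.inl h)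

theorem Cas_le_Sca : Cas ≤ Sca := fun _ h => Subgroup.subset_closure (Or.inr h)

end HSBank

end

noncomputable section

namespace HSBank

open LaurentPolynomial (invert)

/-! Membership in the HS class makes each scalar filter's support symmetric about `1 / 2`, so a
filter with highest exponent `m` has lowest exponent `1 - m` and order `2 * m - 1`. Comparing orders
is thus comparing highest exponents, and all of these are at least 1.

Existence of base factors is a Euclidean reduction. The determinant condition forces the two highest
exponents to have the same parity (`exists_top_eq_add`). If they differ, an antisymmetric binomial
in `z ^ 2` times the shorter filter cancels the leading term of the longer one, and the sum of
highest exponents drops until the orders agree (`exists_Cas_mul_mem_Base`).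

Uniqueness is a growth argument. A nonzero WA filter has highest exponent at least 1, so a
nontrivial lifting step on a filter no longer than its partner makes it strictly longer. Along an
alternating word applied to a base bank each letter reverses the strict inequality, so the orders
never become equal again (`order_lt_of_isAlternating`). Hence only the trivial word carries a base
to a base. Applied to the Haar bank this gives freeness; applied to any base it gives disjointness
of the right cosets. Gain scaling preserves bases, which gives the semidirect product, and `B₀(1) =
1` fixes the gain.

Left cosets fail because right multiplication by a lifting matrix can break the HS symmetry, as it
does for the Haar bank. -/

/-- All exponents of `f` are at most `m`. -/
def DegLE (f : ℝ[T;T⁻¹]) (m : ℤ) : Prop := ∀ n, m < n → f.coeff n = 0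

/-- The highest exponent of `f` is `m`. -/
def IsTop (f : ℝ[T;T⁻¹]) (m : ℤ) : Prop := f.coeff m ≠ 0 ∧ DegLE f m

theorem DegLE.mono {f : ℝ[T;T⁻¹]} {m n : ℤ} (h : DegLE f m) (hmn : m ≤ n) : DegLE f n :=
  fun k hk => h k (hmn.trans_lt hk)

theorem coeff_mul_top {f g : ℝ[T;T⁻¹]} {m n : ℤ} (hf : DegLE f m) (hg : DegLE g n) :
    (f * g).coeff (m + n) = f.coeff m * g.coeff n := by
  rw [AddMonoidAlgebra.coeff_mul_apply_left, Finsupp.sum, Finset.sum_eq_single m]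
  · congr 2; ring
  · intro k hk hkm
    have hle : k ≤ m := not_lt.1 fun h => Finsupp.mem_support_iff.1 hk (hf k h)
    rw [hg (-k + (m + n)) (by have := lt_of_le_of_ne hle hkm; linarith), mul_zero]
  · intro hm
    rw [Finsupp.notMem_support_iff.1 hm, zero_mul]

theorem DegLE.mul {f g : ℝ[T;T⁻¹]} {m n : ℤ} (hf : DegLE f m) (hg : DegLE g n) :
    DegLE (f * g) (m + n) := by
  intro k hk
  rw [show k = (k - n) + n by ring, coeff_mul_top (hf.mono (by linarith)) hg,
    hf (k - n) (by linarith), zero_mul]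

theorem IsTop.mul {f g : ℝ[T;T⁻¹]} {m n : ℤ} (hf : IsTop f m) (hg : IsTop g n) :
    IsTop (f * g) (m + n) :=
  ⟨by rw [coeff_mul_top hf.2 hg.2]; exact mul_ne_zero hf.1 hg.1, hf.2.mul hg.2⟩

theorem exists_isTop {f : ℝ[T;T⁻¹]} (hf : f ≠ 0) : ∃ m, IsTop f m := by
  have hne : f.coeff.support.Nonempty := by
    rw [Finsupp.support_nonempty_iff]
    exact fun h => hf (AddMonoidAlgebra.coeff_eq_zero.1 h)
  refine ⟨f.coeff.support.max' hne, Finsupp.mem_support_iff.1 (Finset.max'_mem _ _), ?_⟩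
  intro n hn
  by_contra h
  exact hn.not_ge (Finset.le_max' _ _ (Finsupp.mem_support_iff.2 h))

theorem IsTop.le_of_degLE {f : ℝ[T;T⁻¹]} {m n : ℤ} (hf : IsTop f m) (h : DegLE f n) : m ≤ n :=
  not_lt.1 fun hlt => hf.1 (h m hlt)

theorem IsTop.add_left {f g : ℝ[T;T⁻¹]} {m n : ℤ} (hf : DegLE f m) (hg : IsTop g n)
    (hmn : m < n) : IsTop (f + g) n := by
  refine ⟨?_, fun k hk => ?_⟩
  · rw [AddMonoidAlgebra.coeff_add, Finsupp.add_apply, hf n hmn, zero_add]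
    exact hg.1
  · rw [AddMonoidAlgebra.coeff_add, Finsupp.add_apply, hf k (hmn.trans hk), hg.2 k hk, add_zero]

/-! ### Symmetric supports and orders -/

/-- The support of `f` is symmetric about `1 / 2`. -/
def SymmSupp (f : ℝ[T;T⁻¹]) : Prop := ∀ n, f.coeff n ≠ 0 → f.coeff (1 - n) ≠ 0

theorem SymmSupp.one_le {f : ℝ[T;T⁻¹]} {m : ℤ} (hs : SymmSupp f) (hf : IsTop f m) : 1 ≤ m := by
  have : 1 - m ≤ m := not_lt.1 fun h => hs m hf.1 (hf.2 _ h)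
  omega

/-- Reflection about `1 / 2` turns the highest exponent `m` into the lowest exponent `1 - m`. -/
theorem SymmSupp.order_eq {f : ℝ[T;T⁻¹]} {m : ℤ} (hs : SymmSupp f) (hf : IsTop f m) :
    order f = 2 * m - 1 := by
  have hm : m ∈ f.coeff.support := Finsupp.mem_support_iff.2 hf.1
  have hle : ∀ k ∈ f.coeff.support, k ≤ m := fun k hk =>
    not_lt.1 fun h => Finsupp.mem_support_iff.1 hk (hf.2 _ h)
  have hne : f.coeff.support.Nonempty := ⟨m, hm⟩
  have hmax : f.coeff.support.max' hne = m :=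
    le_antisymm (Finset.max'_le _ _ _ hle) (Finset.le_max' _ _ hm)
  have hmin : f.coeff.support.min' hne = 1 - m := by
    refine le_antisymm (Finset.min'_le _ _ (Finsupp.mem_support_iff.2 (hs m hf.1)))
      (Finset.le_min' _ _ _ fun k hk => ?_)
    have := hle _ (Finsupp.mem_support_iff.2 (hs k (Finsupp.mem_support_iff.1 hk)))
    linarith
  rw [order, dif_pos hne, hmax, hmin]
  ring

theorem coeff_substSq_even (f : ℝ[T;T⁻¹]) (k : ℤ) : (substSq f).coeff (2 * k) = f.coeff k := by
  have hinj : Function.Injective (fun n : ℤ => 2 * n) := fun a b h => by simpa using h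
  exact Finsupp.mapDomain_apply hinj f.coeff k

theorem coeff_substSq_odd (f : ℝ[T;T⁻¹]) (k : ℤ) : (substSq f).coeff (2 * k + 1) = 0 := by
  refine Finsupp.mapDomain_of_notMem_range f.coeff _ ?_
  rintro ⟨n, hn⟩
  have : 2 * n = 2 * k + 1 := hn
  omega

theorem DegLE.substSq {f : ℝ[T;T⁻¹]} {m : ℤ} (hf : DegLE f m) :
    DegLE (substSq f) (2 * m) := by
  intro n hn
  obtain ⟨k, rfl | rfl⟩ := Int.even_or_odd' n
  · rw [coeff_substSq_even]; exact hf k (by omega)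
  · exact coeff_substSq_odd f k

theorem IsTop.substSq {f : ℝ[T;T⁻¹]} {m : ℤ} (hf : IsTop f m) :
    IsTop (substSq f) (2 * m) :=
  ⟨by rw [coeff_substSq_even]; exact hf.1, hf.2.substSq⟩

/-! ### Whole-sample antisymmetric filters -/

theorem mem_WA_iff {S : ℝ[T;T⁻¹]} : S ∈ WA ↔ ∀ n, S.coeff (-n) = -S.coeff n := by
  constructor
  · intro h n
    have h' : LaurentPolynomial.invert S = -S := h
    rw [← LaurentPolynomial.invert_apply, h']
    simp
  · intro h
    change LaurentPolynomial.invert S = -S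
    ext n
    rw [LaurentPolynomial.invert_apply, h]
    simp

/-- Antisymmetry kills the constant term, and a negative highest exponent `k` would reflect to the
larger exponent `-k`. -/
theorem one_le_of_isTop_of_mem_WA {S : ℝ[T;T⁻¹]} {k : ℤ} (hS : S ∈ WA) (hk : IsTop S k) :
    1 ≤ k := by
  rw [mem_WA_iff] at hS
  by_contra hlt
  rcases (show k = 0 ∨ k < -k by omega) with rfl | h
  · have := hS 0
    rw [neg_zero] at this
    exact hk.1 (by linarith)
  · have := hS k
    rw [hk.2 _ h] at this
    exact hk.1 (by linarith)

/-- The antisymmetric binomial `c (z ^ k - z ^ (-k))`. -/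
def antiBinom (c : ℝ) (k : ℤ) : ℝ[T;T⁻¹] :=
  LaurentPolynomial.C c * (LaurentPolynomial.T k - LaurentPolynomial.T (-k))

theorem antiBinom_mem_WA (c : ℝ) (k : ℤ) : antiBinom c k ∈ WA := by
  change LaurentPolynomial.invert (antiBinom c k) = -antiBinom c k
  simp only [antiBinom, map_mul, map_sub, LaurentPolynomial.invert_C, LaurentPolynomial.invert_T,
    neg_neg]
  ring

theorem coeff_antiBinom (c : ℝ) (k n : ℤ) : (antiBinom c k).coeff n =
    c * ((if k = n then 1 else 0) - (if -k = n then 1 else 0)) := by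
  rw [antiBinom, ← LaurentPolynomial.smul_eq_C_mul]
  simp [mul_sub]

theorem degLE_antiBinom (c : ℝ) {k : ℤ} (hk : 0 < k) : DegLE (antiBinom c k) k := by
  intro n hn
  rw [coeff_antiBinom, if_neg (by omega), if_neg (by omega)]
  simp

theorem coeff_antiBinom_self (c : ℝ) {k : ℤ} (hk : 0 < k) : (antiBinom c k).coeff k = c := by
  rw [coeff_antiBinom, if_pos rfl, if_neg (by omega)]
  simp

/-- Cancellation of the leading term by an antisymmetric multiplier in `z ^ 2`. -/
theorem exists_WA_cancel {f g : ℝ[T;T⁻¹]} {n k : ℤ} (hf : DegLE f (2 * k + n)) (hg : IsTop g n)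
    (hk : 0 < k) : ∃ S ∈ WA, DegLE (f + HSBank.substSq S * g) (2 * k + n - 1) := by
  refine ⟨antiBinom (-(f.coeff (2 * k + n) / g.coeff n)) k, antiBinom_mem_WA _ _, fun j hj => ?_⟩
  have hS := (degLE_antiBinom (-(f.coeff (2 * k + n) / g.coeff n)) hk).substSq
  rw [AddMonoidAlgebra.coeff_add, Finsupp.add_apply]
  rcases (show j = 2 * k + n ∨ 2 * k + n < j by omega) with rfl | h
  · rw [coeff_mul_top hS hg.2, coeff_substSq_even, coeff_antiBinom_self _ hk]
    have := hg.1
    field_simp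
    ring
  · rw [hf j h, hS.mul hg.2 j h, add_zero]

/-! ### HS symmetry and the action of lifting and gain matrices -/

theorem mem_HS_iff {H : Unimod} : H ∈ HS ↔ invert (H.1 0 0) = H.1 0 1 ∧
    invert (H.1 0 1) = H.1 0 0 ∧ invert (H.1 1 0) = -H.1 1 1 ∧ invert (H.1 1 1) = -H.1 1 0 := by
  change H.1.map invert = !![1, 0; 0, -1] * H.1 * !![0, 1; 1, 0] ↔ _
  rw [Matrix.eta_fin_two H.1]
  simp [← Matrix.ext_iff, Fin.forall_fin_two, and_assoc]

theorem det_eq_one (H : Unimod) : H.1 0 0 * H.1 1 1 - H.1 0 1 * H.1 1 0 = 1 := by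
  rw [← Matrix.det_fin_two]; exact H.2

theorem upsilon_mul_row_zero (S : ℝ[T;T⁻¹]) (H : Unimod) (j : Fin 2) :
    (upsilon (.ofAdd S) * H).1 0 j = H.1 0 j + S * H.1 1 j := by
  change (!![1, S; 0, 1] * H.1) 0 j = _
  simp [Matrix.mul_apply, Fin.sum_univ_two]

theorem upsilon_mul_row_one (S : ℝ[T;T⁻¹]) (H : Unimod) (j : Fin 2) :
    (upsilon (.ofAdd S) * H).1 1 j = H.1 1 j := by
  change (!![1, S; 0, 1] * H.1) 1 j = _
  simp [Matrix.mul_apply, Fin.sum_univ_two]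

theorem lambda_mul_row_zero (S : ℝ[T;T⁻¹]) (H : Unimod) (j : Fin 2) :
    (lambda (.ofAdd S) * H).1 0 j = H.1 0 j := by
  change (!![1, 0; S, 1] * H.1) 0 j = _
  simp [Matrix.mul_apply, Fin.sum_univ_two]

theorem lambda_mul_row_one (S : ℝ[T;T⁻¹]) (H : Unimod) (j : Fin 2) :
    (lambda (.ofAdd S) * H).1 1 j = H.1 1 j + S * H.1 0 j := by
  change (!![1, 0; S, 1] * H.1) 1 j = _
  simp [Matrix.mul_apply, Fin.sum_univ_two, add_comm]

theorem gain_mul_row_zero (K : ℝˣ) (H : Unimod) (j : Fin 2) :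
    (gain K * H).1 0 j = LaurentPolynomial.C ((K : ℝ)⁻¹) * H.1 0 j := by
  change (!![LaurentPolynomial.C ((K : ℝ)⁻¹), 0; 0, LaurentPolynomial.C (K : ℝ)] * H.1) 0 j = _
  simp [Matrix.mul_apply, Fin.sum_univ_two]

theorem gain_mul_row_one (K : ℝˣ) (H : Unimod) (j : Fin 2) :
    (gain K * H).1 1 j = LaurentPolynomial.C (K : ℝ) * H.1 1 j := by
  change (!![LaurentPolynomial.C ((K : ℝ)⁻¹), 0; 0, LaurentPolynomial.C (K : ℝ)] * H.1) 1 j = _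
  simp [Matrix.mul_apply, Fin.sum_univ_two]

theorem filt_upsilon_mul_zero (S : ℝ[T;T⁻¹]) (H : Unimod) :
    filt (upsilon (.ofAdd S) * H) 0 = filt H 0 + substSq S * filt H 1 := by
  simp only [filt, upsilon_mul_row_zero, map_add, map_mul]; ring

theorem filt_upsilon_mul_one (S : ℝ[T;T⁻¹]) (H : Unimod) :
    filt (upsilon (.ofAdd S) * H) 1 = filt H 1 := by
  simp only [filt, upsilon_mul_row_one]

theorem filt_lambda_mul_zero (S : ℝ[T;T⁻¹]) (H : Unimod) :
    filt (lambda (.ofAdd S) * H) 0 = filt H 0 := by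
  simp only [filt, lambda_mul_row_zero]

theorem filt_lambda_mul_one (S : ℝ[T;T⁻¹]) (H : Unimod) :
    filt (lambda (.ofAdd S) * H) 1 = filt H 1 + substSq S * filt H 0 := by
  simp only [filt, lambda_mul_row_one, map_add, map_mul]; ring

theorem substSq_C (c : ℝ) : substSq (LaurentPolynomial.C c) = LaurentPolynomial.C c := by
  change AddMonoidAlgebra.mapDomain _ (AddMonoidAlgebra.single 0 c) = AddMonoidAlgebra.single 0 c
  rw [AddMonoidAlgebra.mapDomain_single]
  simp

theorem filt_gain_mul_zero (K : ℝˣ) (H : Unimod) :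
    filt (gain K * H) 0 = (K : ℝ)⁻¹ • filt H 0 := by
  simp only [filt, gain_mul_row_zero, map_mul, substSq_C, LaurentPolynomial.smul_eq_C_mul]; ring

theorem filt_gain_mul_one (K : ℝˣ) (H : Unimod) :
    filt (gain K * H) 1 = (K : ℝ) • filt H 1 := by
  simp only [filt, gain_mul_row_one, map_mul, substSq_C, LaurentPolynomial.smul_eq_C_mul]; ring

theorem upsilon_mul_mem_HS {S : ℝ[T;T⁻¹]} (hS : S ∈ WA) {H : Unimod} (hH : H ∈ HS) :
    upsilon (.ofAdd S) * H ∈ HS := by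
  have hS' : invert S = -S := hS
  obtain ⟨h1, h2, h3, h4⟩ := mem_HS_iff.1 hH
  rw [mem_HS_iff]
  simp only [upsilon_mul_row_zero, upsilon_mul_row_one, map_add, map_mul, h1, h2, h3, h4, hS',
    neg_mul_neg, and_self]

theorem lambda_mul_mem_HS {S : ℝ[T;T⁻¹]} (hS : S ∈ WA) {H : Unimod} (hH : H ∈ HS) :
    lambda (.ofAdd S) * H ∈ HS := by
  have hS' : invert S = -S := hS
  obtain ⟨h1, h2, h3, h4⟩ := mem_HS_iff.1 hH
  rw [mem_HS_iff]
  simp only [lambda_mul_row_zero, lambda_mul_row_one, map_add, map_mul, h1, h2, h3, h4, hS',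
    neg_mul, neg_add, and_self]

theorem gain_mul_mem_HS (K : ℝˣ) {H : Unimod} (hH : H ∈ HS) : gain K * H ∈ HS := by
  obtain ⟨h1, h2, h3, h4⟩ := mem_HS_iff.1 hH
  rw [mem_HS_iff]
  simp only [gain_mul_row_zero, gain_mul_row_one, map_mul, h1, h2, h3, h4,
    LaurentPolynomial.invert_C, mul_neg, and_self]

theorem coeff_T_one_mul (f : ℝ[T;T⁻¹]) (n : ℤ) :
    (LaurentPolynomial.T 1 * f).coeff n = f.coeff (n - 1) := by
  rw [LaurentPolynomial.T, AddMonoidAlgebra.coeff_single_mul_apply, one_mul]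
  congr 1; ring

theorem coeff_filt_even (H : Unimod) (i : Fin 2) (k : ℤ) :
    (filt H i).coeff (2 * k) = (H.1 i 0).coeff k := by
  rw [filt, AddMonoidAlgebra.coeff_add, Finsupp.add_apply, coeff_substSq_even, coeff_T_one_mul,
    show 2 * k - 1 = 2 * (k - 1) + 1 by ring, coeff_substSq_odd, add_zero]

theorem coeff_filt_odd (H : Unimod) (i : Fin 2) (k : ℤ) :
    (filt H i).coeff (2 * k + 1) = (H.1 i 1).coeff k := by
  rw [filt, AddMonoidAlgebra.coeff_add, Finsupp.add_apply, coeff_substSq_odd, coeff_T_one_mul,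
    add_sub_cancel_right, coeff_substSq_even, zero_add]

/-- Inversion swaps the two polyphase components up to sign, which matches exponent `2 * k` with `1
- 2 * k`. -/
theorem symmSupp_filt {H : Unimod} (hH : H ∈ HS) (i : Fin 2) : SymmSupp (filt H i) := by
  obtain ⟨h1, h2, h3, h4⟩ := mem_HS_iff.1 hH
  have key : ∀ k, ((H.1 i 0).coeff k ≠ 0 → (H.1 i 1).coeff (-k) ≠ 0) ∧
      ((H.1 i 1).coeff k ≠ 0 → (H.1 i 0).coeff (-k) ≠ 0) := by
    intro k
    rw [← LaurentPolynomial.invert_apply, ← LaurentPolynomial.invert_apply]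
    fin_cases i
    · simp [h1, h2]
    · simp [h3, h4]
  intro n hn
  obtain ⟨k, rfl | rfl⟩ := Int.even_or_odd' n
  · rw [show 1 - 2 * k = 2 * (-k) + 1 by ring, coeff_filt_odd]
    rw [coeff_filt_even] at hn
    exact (key k).1 hn
  · rw [show 1 - (2 * k + 1) = 2 * (-k) by ring, coeff_filt_even]
    rw [coeff_filt_odd] at hn
    exact (key k).2 hn

theorem filt_ne_zero (H : Unimod) (i : Fin 2) : filt H i ≠ 0 := by
  intro h
  have h0 : H.1 i 0 = 0 := by
    ext k; rw [← coeff_filt_even, h]; rfl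
  have h1 : H.1 i 1 = 0 := by
    ext k; rw [← coeff_filt_odd, h]; rfl
  have hd := det_eq_one H
  fin_cases i
  · simp only [Fin.zero_eta] at h0 h1
    simp [h0, h1] at hd
  · simp only [Fin.mk_one] at h0 h1
    simp [h0, h1] at hd

theorem even_isTop_filt {H : Unimod} {i : Fin 2} {p : ℤ} (h : IsTop (filt H i) (2 * p)) :
    IsTop (H.1 i 0) p ∧ DegLE (H.1 i 1) (p - 1) := by
  refine ⟨⟨?_, fun k hk => ?_⟩, fun k hk => ?_⟩
  · rw [← coeff_filt_even]; exact h.1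
  · rw [← coeff_filt_even]; exact h.2 _ (by omega)
  · rw [← coeff_filt_odd]; exact h.2 _ (by omega)

theorem odd_isTop_filt {H : Unimod} {i : Fin 2} {p : ℤ} (h : IsTop (filt H i) (2 * p + 1)) :
    IsTop (H.1 i 1) p ∧ DegLE (H.1 i 0) p := by
  refine ⟨⟨?_, fun k hk => ?_⟩, fun k hk => ?_⟩
  · rw [← coeff_filt_odd]; exact h.1
  · rw [← coeff_filt_odd]; exact h.2 _ (by omega)
  · rw [← coeff_filt_even]; exact h.2 _ (by omega)

/-! ### Parity of the highest exponents and growth of order under lifting -/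

theorem coeff_mul_sub_mul_ne_zero {a b c d : ℝ[T;T⁻¹]} {p q : ℤ} (ha : IsTop a p) (hd : IsTop d q)
    (hb : DegLE b (p - 1)) (hc : DegLE c q) :
    (a * d - b * c).coeff (p + q) ≠ 0 := by
  rw [AddMonoidAlgebra.coeff_sub, Finsupp.sub_apply, hb.mul hc (p + q) (by omega), sub_zero]
  exact (ha.mul hd).1

/-- In an HS bank, the highest exponents of the two filters have the same parity. -/
theorem exists_top_eq_add {H : Unimod} (hH : H ∈ HS) {m n : ℤ} (hm : IsTop (filt H 0) m)
    (hn : IsTop (filt H 1) n) : ∃ k, m = 2 * k + n := by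
  have hm1 := (symmSupp_filt hH 0).one_le hm
  have hn1 := (symmSupp_filt hH 1).one_le hn
  have hd := det_eq_one H
  obtain ⟨p, rfl | rfl⟩ := Int.even_or_odd' m <;> obtain ⟨q, rfl | rfl⟩ := Int.even_or_odd' n
  · exact ⟨p - q, by ring⟩
  · obtain ⟨ha, hb⟩ := even_isTop_filt hm
    obtain ⟨hd', hc⟩ := odd_isTop_filt hn
    refine absurd ?_ (coeff_mul_sub_mul_ne_zero ha hd' hb hc)
    -- Since `p ≥ 1` and `q ≥ 0`, the exponent `p + q` is positive, but the determinant is the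
    -- constant 1.
    rw [hd, ← LaurentPolynomial.T_zero, LaurentPolynomial.T_apply, if_neg (by omega)]
  · obtain ⟨hb, ha⟩ := odd_isTop_filt hm
    obtain ⟨hc, hd'⟩ := even_isTop_filt hn
    refine absurd ?_ (coeff_mul_sub_mul_ne_zero hc hb hd' ha)
    rw [show H.1 1 0 * H.1 0 1 - H.1 1 1 * H.1 0 0 = -1 by linear_combination -hd,
      ← LaurentPolynomial.T_zero, AddMonoidAlgebra.coeff_neg, Finsupp.neg_apply,
      LaurentPolynomial.T_apply, if_neg (by omega), neg_zero]
  · exact ⟨p - q, by ring⟩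

theorem order_filt_eq {H : Unimod} (hH : H ∈ HS) {i : Fin 2} {m : ℤ} (h : IsTop (filt H i) m) :
    order (filt H i) = 2 * m - 1 :=
  (symmSupp_filt hH i).order_eq h

/-- With `k ≥ 1` the lifted term has highest exponent `2 * k + n`, above that of the old filter, so
nothing cancels. -/
theorem order_lt_of_upsilon {S : ℝ[T;T⁻¹]} (hS : S ∈ WA) (hS0 : S ≠ 0) {H : Unimod} (hH : H ∈ HS)
    (h : order (filt H 0) ≤ order (filt H 1)) :
    order (filt (upsilon (.ofAdd S) * H) 1) < order (filt (upsilon (.ofAdd S) * H) 0) := by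
  obtain ⟨m, hm⟩ := exists_isTop (filt_ne_zero H 0)
  obtain ⟨n, hn⟩ := exists_isTop (filt_ne_zero H 1)
  obtain ⟨k, hk⟩ := exists_isTop hS0
  have hk1 := one_le_of_isTop_of_mem_WA hS hk
  rw [order_filt_eq hH hm, order_filt_eq hH hn] at h
  have htop : IsTop (filt (upsilon (.ofAdd S) * H) 0) (2 * k + n) := by
    rw [filt_upsilon_mul_zero]
    exact IsTop.add_left hm.2 (hk.substSq.mul hn) (by omega)
  rw [order_filt_eq (upsilon_mul_mem_HS hS hH) htop, filt_upsilon_mul_one, order_filt_eq hH hn]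
  omega

theorem order_lt_of_lambda {S : ℝ[T;T⁻¹]} (hS : S ∈ WA) (hS0 : S ≠ 0) {H : Unimod} (hH : H ∈ HS)
    (h : order (filt H 1) ≤ order (filt H 0)) :
    order (filt (lambda (.ofAdd S) * H) 0) < order (filt (lambda (.ofAdd S) * H) 1) := by
  obtain ⟨m, hm⟩ := exists_isTop (filt_ne_zero H 0)
  obtain ⟨n, hn⟩ := exists_isTop (filt_ne_zero H 1)
  obtain ⟨k, hk⟩ := exists_isTop hS0
  have hk1 := one_le_of_isTop_of_mem_WA hS hk
  rw [order_filt_eq hH hm, order_filt_eq hH hn] at h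
  have htop : IsTop (filt (lambda (.ofAdd S) * H) 1) (2 * k + m) := by
    rw [filt_lambda_mul_one]
    exact IsTop.add_left hn.2 (hk.substSq.mul hm) (by omega)
  rw [order_filt_eq (lambda_mul_mem_HS hS hH) htop, filt_lambda_mul_zero, order_filt_eq hH hm]
  omega

/-! ### Reduction to equal-length base banks -/

theorem upsilon_mem_Cas {S : ℝ[T;T⁻¹]} (hS : S ∈ WA) : upsilon (.ofAdd S) ∈ Cas :=
  U_le_Cas ⟨.ofAdd S, hS, rfl⟩

theorem lambda_mem_Cas {S : ℝ[T;T⁻¹]} (hS : S ∈ WA) : lambda (.ofAdd S) ∈ Cas :=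
  L_le_Cas ⟨.ofAdd S, hS, rfl⟩

theorem exists_Cas_mul_mem_Base {H : Unimod} (hH : H ∈ HS) : ∃ c ∈ Cas, c * H ∈ Base := by
  obtain ⟨m, hm⟩ := exists_isTop (filt_ne_zero H 0)
  obtain ⟨n, hn⟩ := exists_isTop (filt_ne_zero H 1)
  -- Induction on a bound for the sum of highest exponents; the bound 0 is impossible because both
  -- are at least 1.
  obtain ⟨N, hN⟩ : ∃ N : ℕ, m + n ≤ N := ⟨(m + n).toNat, by omega⟩
  induction N generalizing H m n with
  | zero =>
    have := (symmSupp_filt hH 0).one_le hm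
    have := (symmSupp_filt hH 1).one_le hn
    omega
  | succ N ih =>
    obtain ⟨k, rfl⟩ := exists_top_eq_add hH hm hn
    push_cast at hN
    rcases lt_trichotomy k 0 with hk | rfl | hk
    · obtain ⟨S, hS, hdeg⟩ := exists_WA_cancel (f := filt H 1) (k := -k) (n := 2 * k + n)
        (hn.2.mono (by omega)) hm (by omega)
      rw [← filt_lambda_mul_one] at hdeg
      have hH' := lambda_mul_mem_HS hS hH
      obtain ⟨n', hn'⟩ := exists_isTop (filt_ne_zero (lambda (.ofAdd S) * H) 1)
      have hle := hn'.le_of_degLE hdeg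
      have hm' : IsTop (filt (lambda (.ofAdd S) * H) 0) (2 * k + n) := by
        rw [filt_lambda_mul_zero]; exact hm
      obtain ⟨c, hc, hcB⟩ := ih hH' _ hm' _ hn' (by omega)
      refine ⟨c * lambda (.ofAdd S), Cas.mul_mem hc (lambda_mem_Cas hS), ?_⟩
      rw [mul_assoc]
      exact hcB
    · refine ⟨1, Cas.one_mem, ?_⟩
      rw [one_mul]
      refine ⟨hH, ?_⟩
      rw [order_filt_eq hH hm, order_filt_eq hH hn]
      ring
    · obtain ⟨S, hS, hdeg⟩ := exists_WA_cancel hm.2 hn hk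
      rw [← filt_upsilon_mul_zero] at hdeg
      have hH' := upsilon_mul_mem_HS hS hH
      obtain ⟨m', hm'⟩ := exists_isTop (filt_ne_zero (upsilon (.ofAdd S) * H) 0)
      have hle := hm'.le_of_degLE hdeg
      have hn' : IsTop (filt (upsilon (.ofAdd S) * H) 1) n := by
        rw [filt_upsilon_mul_one]; exact hn
      obtain ⟨c, hc, hcB⟩ := ih hH' _ hm' _ hn' (by omega)
      refine ⟨c * upsilon (.ofAdd S), Cas.mul_mem hc (upsilon_mem_Cas hS), ?_⟩
      rw [mul_assoc]
      exact hcB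

theorem IsTop.smul {f : ℝ[T;T⁻¹]} {m : ℤ} (hf : IsTop f m) {r : ℝ} (hr : r ≠ 0) :
    IsTop (r • f) m :=
  ⟨mul_ne_zero hr hf.1, fun n hn => by
    rw [AddMonoidAlgebra.coeff_smul_apply, hf.2 n hn, smul_zero]⟩

theorem gain_mul_mem_Base (K : ℝˣ) {B : Unimod} (hB : B ∈ Base) : gain K * B ∈ Base := by
  obtain ⟨hH, ho⟩ := hB
  obtain ⟨m, hm⟩ := exists_isTop (filt_ne_zero B 0)
  obtain ⟨n, hn⟩ := exists_isTop (filt_ne_zero B 1)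
  have hH' := gain_mul_mem_HS K hH
  have hm' : IsTop (filt (gain K * B) 0) m := by
    rw [filt_gain_mul_zero]; exact hm.smul (inv_ne_zero K.ne_zero)
  have hn' : IsTop (filt (gain K * B) 1) n := by
    rw [filt_gain_mul_one]; exact hn.smul K.ne_zero
  refine ⟨hH', ?_⟩
  rw [order_filt_eq hH' hm', order_filt_eq hH' hn', ← order_filt_eq hH hm, ← order_filt_eq hH hn, ho]

theorem Cas_mul_mem_HS {c H : Unimod} (hc : c ∈ Cas) (hH : H ∈ HS) : c * H ∈ HS := by
  induction hc using Subgroup.closure_induction'' generalizing H with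
  | mem x hx =>
    obtain ⟨S, hS, rfl⟩ | ⟨S, hS, rfl⟩ := hx
    · exact upsilon_mul_mem_HS hS hH
    · exact lambda_mul_mem_HS hS hH
  | inv_mem x hx =>
    obtain ⟨S, hS, rfl⟩ | ⟨S, hS, rfl⟩ := hx
    · rw [← map_inv]; exact upsilon_mul_mem_HS (WA.neg_mem hS) hH
    · rw [← map_inv]; exact lambda_mul_mem_HS (WA.neg_mem hS) hH
  | one => rwa [one_mul]
  | mul x y _ _ hx hy => rw [mul_assoc]; exact hx (hy hH)

/-! ### The Haar bank and the value at `z = 1` -/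

/-- The normalized Haar filter bank. -/
def haar : Unimod :=
  ⟨!![LaurentPolynomial.C (1 / 2), LaurentPolynomial.C (1 / 2); -1, 1], by
    rw [Matrix.det_fin_two_of, mul_one, mul_neg, mul_one, sub_neg_eq_add, ← map_add]
    norm_num⟩

theorem haar_mem_HS : haar ∈ HS := by
  rw [mem_HS_iff]
  simp [haar]

/-- At `z = 1` the two entries of the first row coincide, so a zero sum would make the row vanish
and the determinant with it. -/
theorem eval_filt_zero_ne_zero {H : Unimod} (hH : H ∈ HS) :
    LaurentPolynomial.eval₂ (RingHom.id ℝ) (1 : ℝˣ) (filt H 0) ≠ 0 := by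
  obtain ⟨h1, h2, h3, h4⟩ := mem_HS_iff.1 hH
  set e := LaurentPolynomial.eval₂ (RingHom.id ℝ) (1 : ℝˣ) with he
  have einv : ∀ f : ℝ[T;T⁻¹], e (invert f) = e f := by
    intro f
    induction f using LaurentPolynomial.induction_on' with
    | add p q hp hq => rw [map_add, map_add, map_add, hp, hq]
    | C_mul_T n a =>
      simp [he]
  have esq : ∀ f : ℝ[T;T⁻¹], e (substSq f) = e f := by
    intro f
    induction f using LaurentPolynomial.induction_on' with
    | add p q hp hq => rw [map_add, map_add, map_add, hp, hq]
    | C_mul_T n a =>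
      have : substSq (LaurentPolynomial.T n) = LaurentPolynomial.T (2 * n) :=
        AddMonoidAlgebra.mapDomain_single
      simp [he, substSq_C, this]
  have eT : e (LaurentPolynomial.T 1) = 1 := by simp [he, LaurentPolynomial.eval₂_T]
  have h01 : e (H.1 0 1) = e (H.1 0 0) := by rw [← h1, einv]
  have hd := congrArg e (det_eq_one H)
  rw [map_sub, map_mul, map_mul, map_one, h01] at hd
  rw [filt, map_add, map_mul, eT, esq, esq, h01, one_mul]
  intro h0
  have : e (H.1 0 0) = 0 := by linarith
  rw [this] at hd
  simp at hd

theorem isTop_filt_haar (i : Fin 2) : IsTop (filt haar i) 1 := by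
  have h0 : ∀ j : Fin 2, ∃ c : ℝ, c ≠ 0 ∧ haar.1 i j = LaurentPolynomial.C c := by
    intro j
    fin_cases i <;> fin_cases j
    · exact ⟨1 / 2, by norm_num, rfl⟩
    · exact ⟨1 / 2, by norm_num, rfl⟩
    · exact ⟨-1, by norm_num, by simp [haar]⟩
    · exact ⟨1, by norm_num, by simp [haar]⟩
  obtain ⟨a, ha, ha'⟩ := h0 0
  obtain ⟨b, hb, hb'⟩ := h0 1
  refine ⟨?_, fun n hn => ?_⟩
  · rw [show (1 : ℤ) = 2 * 0 + 1 by norm_num, coeff_filt_odd, hb', LaurentPolynomial.C_apply,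
      if_pos rfl]
    exact hb
  · obtain ⟨k, rfl | rfl⟩ := Int.even_or_odd' n
    · rw [coeff_filt_even, ha', LaurentPolynomial.C_apply, if_neg (by omega)]
    · rw [coeff_filt_odd, hb', LaurentPolynomial.C_apply, if_neg (by omega)]

theorem haar_mem_Base : haar ∈ Base := by
  refine ⟨haar_mem_HS, ?_⟩
  rw [order_filt_eq haar_mem_HS (isTop_filt_haar 0), order_filt_eq haar_mem_HS (isTop_filt_haar 1)]

/-! ### Alternating words and freeness -/

/-- Nonempty alternating products of nontrivial letters in a free product; the flag is `true` if
the first letter comes from the left factor. -/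
inductive IsAlternating {A B : Type*} [Group A] [Group B] : Bool → Monoid.Coprod A B → Prop
  | inl {a : A} (ha : a ≠ 1) : IsAlternating true (Monoid.Coprod.inl a)
  | inr {b : B} (hb : b ≠ 1) : IsAlternating false (Monoid.Coprod.inr b)
  | inl_mul {a : A} (ha : a ≠ 1) {w : Monoid.Coprod A B} (hw : IsAlternating false w) :
      IsAlternating true (Monoid.Coprod.inl a * w)
  | inr_mul {b : B} (hb : b ≠ 1) {w : Monoid.Coprod A B} (hw : IsAlternating true w) :
      IsAlternating false (Monoid.Coprod.inr b * w)

/-- A new letter is prepended to, merged with, or cancelled against the first letter of an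
alternating word. Uniqueness of the normal form is not needed. -/
theorem eq_one_or_isAlternating {A B : Type*} [Group A] [Group B] (w : Monoid.Coprod A B) :
    w = 1 ∨ ∃ s, IsAlternating s w := by
  induction w using Monoid.Coprod.induction_on' with
  | one => exact .inl rfl
  | inl_mul a w ih =>
    by_cases ha : a = 1
    · rwa [ha, map_one, one_mul]
    obtain rfl | ⟨s, hs⟩ := ih
    · rw [mul_one]; exact .inr ⟨_, .inl ha⟩
    cases hs with
    | @inl a' ha' =>
      rw [← map_mul]
      by_cases h : a * a' = 1
      · exact .inl (by rw [h, map_one])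
      · exact .inr ⟨_, .inl h⟩
    | inr hb => exact .inr ⟨_, .inl_mul ha (.inr hb)⟩
    | @inl_mul a' ha' w' hw' =>
      rw [← mul_assoc, ← map_mul]
      by_cases h : a * a' = 1
      · rw [h, map_one, one_mul]; exact .inr ⟨_, hw'⟩
      · exact .inr ⟨_, .inl_mul h hw'⟩
    | inr_mul hb hw' => exact .inr ⟨_, .inl_mul ha (.inr_mul hb hw')⟩
  | inr_mul b w ih =>
    by_cases hb : b = 1
    · rwa [hb, map_one, one_mul]
    obtain rfl | ⟨s, hs⟩ := ih
    · rw [mul_one]; exact .inr ⟨_, .inr hb⟩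
    cases hs with
    | @inr b' hb' =>
      rw [← map_mul]
      by_cases h : b * b' = 1
      · exact .inl (by rw [h, map_one])
      · exact .inr ⟨_, .inr h⟩
    | inl ha => exact .inr ⟨_, .inr_mul hb (.inl ha)⟩
    | @inr_mul b' hb' w' hw' =>
      rw [← mul_assoc, ← map_mul]
      by_cases h : b * b' = 1
      · rw [h, map_one, one_mul]; exact .inr ⟨_, hw'⟩
      · exact .inr ⟨_, .inr_mul h hw'⟩
    | inl_mul ha hw' => exact .inr ⟨_, .inr_mul hb (.inl_mul ha hw')⟩

theorem U_order_lt {u : U} (hu : u ≠ 1) {H : Unimod} (hH : H ∈ HS)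
    (h : order (filt H 0) ≤ order (filt H 1)) :
    order (filt (u.1 * H) 1) < order (filt (u.1 * H) 0) := by
  obtain ⟨_, S, hS, rfl⟩ := u
  refine order_lt_of_upsilon hS ?_ hH h
  rintro h0
  apply hu
  ext1
  have : S = 1 := h0
  change upsilon S = 1
  rw [this, map_one]

theorem L_order_lt {l : L} (hl : l ≠ 1) {H : Unimod} (hH : H ∈ HS)
    (h : order (filt H 1) ≤ order (filt H 0)) :
    order (filt (l.1 * H) 0) < order (filt (l.1 * H) 1) := by
  obtain ⟨_, S, hS, rfl⟩ := l
  refine order_lt_of_lambda hS ?_ hH h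
  rintro h0
  apply hl
  ext1
  have : S = 1 := h0
  change lambda S = 1
  rw [this, map_one]

/-- The canonical homomorphism `𝒰 ∗ ℒ → 𝒞`. -/
def casOfCoprod : Monoid.Coprod U L →* Cas :=
  Monoid.Coprod.lift (Subgroup.inclusion U_le_Cas) (Subgroup.inclusion L_le_Cas)

theorem casOfCoprod_inl (u : U) : (casOfCoprod (Monoid.Coprod.inl u) : Unimod) = u := rfl

theorem casOfCoprod_inr (l : L) : (casOfCoprod (Monoid.Coprod.inr l) : Unimod) = l := rfl

/-- The last letter meets equal orders; every further letter meets the strict inequality left by the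
previous one, in the direction its growth lemma needs. -/
theorem order_lt_of_isAlternating {s : Bool} {w : Monoid.Coprod U L} (hw : IsAlternating s w)
    {B : Unimod} (hB : B ∈ Base) :
    cond s
      (order (filt ((casOfCoprod w : Unimod) * B) 1) < order (filt ((casOfCoprod w : Unimod) * B) 0))
      (order (filt ((casOfCoprod w : Unimod) * B) 0) <
        order (filt ((casOfCoprod w : Unimod) * B) 1)) := by
  induction hw with
  | inl ha => exact U_order_lt ha hB.1 hB.2.le
  | inr hb => exact L_order_lt hb hB.1 hB.2.ge
  | @inl_mul a ha w hw ih =>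
    rw [map_mul, Subgroup.coe_mul, casOfCoprod_inl, mul_assoc]
    exact U_order_lt ha (Cas_mul_mem_HS (casOfCoprod w).2 hB.1) (le_of_lt ih)
  | @inr_mul b hb w hw ih =>
    rw [map_mul, Subgroup.coe_mul, casOfCoprod_inr, mul_assoc]
    exact L_order_lt hb (Cas_mul_mem_HS (casOfCoprod w).2 hB.1) (le_of_lt ih)

theorem eq_one_of_casOfCoprod_mul_mem_Base {w : Monoid.Coprod U L} {B : Unimod} (hB : B ∈ Base)
    (h : (casOfCoprod w : Unimod) * B ∈ Base) : w = 1 := by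
  obtain rfl | ⟨s, hs⟩ := eq_one_or_isAlternating w
  · rfl
  · have := order_lt_of_isAlternating hs hB
    cases s
    · exact absurd h.2 (ne_of_lt this)
    · exact absurd h.2 (ne_of_gt this)

theorem casOfCoprod_injective : Function.Injective casOfCoprod := by
  rw [injective_iff_map_eq_one]
  intro w hw
  refine eq_one_of_casOfCoprod_mul_mem_Base haar_mem_Base ?_
  rw [hw, Subgroup.coe_one, one_mul]
  exact haar_mem_Base

theorem casOfCoprod_surjective : Function.Surjective casOfCoprod := by
  have hle : Cas ≤ casOfCoprod.range.map Cas.subtype := by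
    refine (Subgroup.closure_le _).2 ?_
    rintro x (hx | hx)
    · exact ⟨_, ⟨Monoid.Coprod.inl ⟨x, hx⟩, rfl⟩, rfl⟩
    · exact ⟨_, ⟨Monoid.Coprod.inr ⟨x, hx⟩, rfl⟩, rfl⟩
  rintro ⟨c, hc⟩
  obtain ⟨_, ⟨w, rfl⟩, hw⟩ := hle hc
  exact ⟨w, Subtype.ext hw⟩

theorem eq_one_of_Cas_mul_mem_Base {c B : Unimod} (hc : c ∈ Cas) (hB : B ∈ Base)
    (h : c * B ∈ Base) : c = 1 := by
  obtain ⟨w, hw⟩ := casOfCoprod_surjective ⟨c, hc⟩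
  have hw' : (casOfCoprod w : Unimod) = c := by rw [hw]
  rw [← hw'] at h ⊢
  rw [eq_one_of_casOfCoprod_mul_mem_Base hB h, map_one, Subgroup.coe_one]

/-- `𝒞 ≅ 𝒰 ∗ ℒ`. -/
def casEquiv : Cas ≃* Monoid.Coprod U L :=
  (MulEquiv.ofBijective casOfCoprod ⟨casOfCoprod_injective, casOfCoprod_surjective⟩).symm

theorem casEquiv_casOfCoprod (w : Monoid.Coprod U L) : casEquiv (casOfCoprod w) = w :=
  (MulEquiv.ofBijective casOfCoprod ⟨casOfCoprod_injective, casOfCoprod_surjective⟩).symm_apply_apply w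

theorem casOfCoprod_casEquiv (c : Cas) : casOfCoprod (casEquiv c) = c :=
  (MulEquiv.ofBijective casOfCoprod ⟨casOfCoprod_injective, casOfCoprod_surjective⟩).apply_symm_apply c

theorem casOfCoprod_theta (d : D) (w : Monoid.Coprod U L) :
    casOfCoprod (theta d w) = gamma Cas D_le_normalizer_Cas d (casOfCoprod w) := by
  have : casOfCoprod.comp (theta d).toMonoidHom =
      (gamma Cas D_le_normalizer_Cas d).toMonoidHom.comp casOfCoprod :=
    Monoid.Coprod.hom_ext rfl rfl
  exact DFunLike.congr_fun this w

theorem coe_casOfCoprod_theta (d : D) (w : Monoid.Coprod U L) :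
    (casOfCoprod (theta d w) : Unimod) = d * casOfCoprod w * (d : Unimod)⁻¹ := by
  rw [casOfCoprod_theta]; rfl

/-! ### The semidirect product -/

/-- The canonical homomorphism `𝒟 ⋉ (𝒰 ∗ ℒ) → 𝒮`. -/
def scaOfSemidirect : SemidirectProduct (Monoid.Coprod U L) D theta →* Sca :=
  SemidirectProduct.lift ((Subgroup.inclusion Cas_le_Sca).comp casOfCoprod)
    (Subgroup.inclusion D_le_Sca) fun d =>
      MonoidHom.ext fun w => Subtype.ext (coe_casOfCoprod_theta d w)

theorem coe_scaOfSemidirect (x : SemidirectProduct (Monoid.Coprod U L) D theta) :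
    (scaOfSemidirect x : Unimod) = casOfCoprod x.left * x.right := rfl

theorem D_mul_mem_Base {d B : Unimod} (hd : d ∈ D) (hB : B ∈ Base) : d * B ∈ Base := by
  obtain ⟨K, rfl⟩ := hd
  exact gain_mul_mem_Base K hB

theorem scaOfSemidirect_injective : Function.Injective scaOfSemidirect := by
  rw [injective_iff_map_eq_one]
  intro x hx
  have h : (casOfCoprod x.left : Unimod) * x.right = 1 := by
    rw [← coe_scaOfSemidirect, hx, Subgroup.coe_one]
  have hl : x.left = 1 := by
    refine eq_one_of_casOfCoprod_mul_mem_Base haar_mem_Base ?_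
    -- The cascade factor is the inverse of a gain matrix, so it maps bases to bases and must be
    -- trivial.
    rw [eq_inv_of_mul_eq_one_left h]
    exact D_mul_mem_Base (D.inv_mem x.right.2) haar_mem_Base
  refine SemidirectProduct.ext hl (Subtype.ext ?_)
  rw [hl, map_one, Subgroup.coe_one, one_mul] at h
  exact h

theorem scaOfSemidirect_surjective : Function.Surjective scaOfSemidirect := by
  have hle : Sca ≤ scaOfSemidirect.range.map Sca.subtype := by
    refine (Subgroup.closure_le _).2 ?_
    rintro x (hx | hx)
    · refine ⟨_, ⟨SemidirectProduct.inr ⟨x, hx⟩, rfl⟩, ?_⟩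
      rw [Subgroup.subtype_apply, coe_scaOfSemidirect]
      simp
    · obtain ⟨w, hw⟩ := casOfCoprod_surjective ⟨x, hx⟩
      refine ⟨_, ⟨SemidirectProduct.inl w, rfl⟩, ?_⟩
      rw [Subgroup.subtype_apply, coe_scaOfSemidirect]
      simp [hw]
  rintro ⟨c, hc⟩
  obtain ⟨_, ⟨w, rfl⟩, hw⟩ := hle hc
  exact ⟨w, Subtype.ext hw⟩

/-- `𝒮 ≅ 𝒟 ⋉ (𝒰 ∗ ℒ)`. -/
def scaEquiv : Sca ≃* SemidirectProduct (Monoid.Coprod U L) D theta :=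
  (MulEquiv.ofBijective scaOfSemidirect
    ⟨scaOfSemidirect_injective, scaOfSemidirect_surjective⟩).symm

theorem scaEquiv_mul (d : D) (c : Cas) :
    scaEquiv (Subgroup.inclusion D_le_Sca d * Subgroup.inclusion Cas_le_Sca c) =
      SemidirectProduct.inr d * SemidirectProduct.inl (casEquiv c) := by
  rw [scaEquiv, MulEquiv.symm_apply_eq]
  change _ = scaOfSemidirect _
  rw [map_mul, scaOfSemidirect, SemidirectProduct.lift_inr, SemidirectProduct.lift_inl,
    MonoidHom.comp_apply, casOfCoprod_casEquiv]

theorem exists_mul_of_mem_Sca {s : Unimod} (hs : s ∈ Sca) : ∃ c ∈ Cas, ∃ d ∈ D, s = c * d := by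
  obtain ⟨x, hx⟩ := scaOfSemidirect_surjective ⟨s, hs⟩
  refine ⟨_, (casOfCoprod x.left).2, _, x.right.2, ?_⟩
  rw [← coe_scaOfSemidirect, hx]

theorem Sca_mul_mem_HS {s H : Unimod} (hs : s ∈ Sca) (hH : H ∈ HS) : s * H ∈ HS := by
  obtain ⟨c, hc, _, ⟨K, rfl⟩, rfl⟩ := exists_mul_of_mem_Sca hs
  rw [mul_assoc]
  exact Cas_mul_mem_HS hc (gain_mul_mem_HS K hH)

/-! ### Right cosets -/

theorem mem_op_smul_subgroup {G : Type*} [Group G] {M : Subgroup G} {B x : G} :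
    x ∈ MulOpposite.op B • (M : Set G) ↔ ∃ m ∈ M, m * B = x := by
  rw [Set.mem_smul_set]; rfl

theorem eval_filt_gain_mul (K : ℝˣ) (H : Unimod) :
    LaurentPolynomial.eval₂ (RingHom.id ℝ) (1 : ℝˣ) (filt (gain K * H) 0) =
      (K : ℝ)⁻¹ * LaurentPolynomial.eval₂ (RingHom.id ℝ) (1 : ℝˣ) (filt H 0) := by
  rw [filt_gain_mul_zero, LaurentPolynomial.smul_eq_C_mul, map_mul, LaurentPolynomial.eval₂_C]
  rfl

theorem HS_eq_iUnion_Cas : HS = ⋃ B ∈ Base, MulOpposite.op B • (Cas : Set Unimod) := by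
  ext H
  simp only [Set.mem_iUnion, mem_op_smul_subgroup, exists_prop]
  constructor
  · intro hH
    obtain ⟨c, hc, hB⟩ := exists_Cas_mul_mem_Base hH
    exact ⟨_, hB, c⁻¹, Cas.inv_mem hc, inv_mul_cancel_left c H⟩
  · rintro ⟨B, hB, c, hc, rfl⟩
    exact Cas_mul_mem_HS hc hB.1

theorem HS_eq_iUnion_Sca : HS = ⋃ B ∈ NormBase, MulOpposite.op B • (Sca : Set Unimod) := by
  ext H
  simp only [Set.mem_iUnion, mem_op_smul_subgroup, exists_prop]
  constructor
  · intro hH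
    obtain ⟨c, hc, hB⟩ := exists_Cas_mul_mem_Base hH
    have he := eval_filt_zero_ne_zero hB.1
    -- `gain K` divides the first filter by `K`, so taking `K` to be its value at 1 normalizes it.
    refine ⟨gain (Units.mk0 _ he) * (c * H), ⟨gain_mul_mem_Base _ hB, ?_⟩,
      (gain (Units.mk0 _ he) * c)⁻¹,
      Sca.inv_mem (Sca.mul_mem (D_le_Sca ⟨_, rfl⟩) (Cas_le_Sca hc)), ?_⟩
    · rw [eval_filt_gain_mul, Units.val_mk0, inv_mul_cancel₀ he]
    · rw [← mul_assoc (gain _), inv_mul_cancel_left]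
  · rintro ⟨B, hB, s, hs, rfl⟩
    exact Sca_mul_mem_HS hs hB.1.1

theorem pairwiseDisjoint_op_smul {G : Type*} [Group G] {M : Subgroup G} {X : Set G}
    (h : ∀ m ∈ M, ∀ B ∈ X, m * B ∈ X → m * B = B) :
    X.PairwiseDisjoint fun B => MulOpposite.op B • (M : Set G) := by
  intro B hB B' hB' hne
  refine Set.disjoint_left.2 fun x hx hx' => hne ?_
  obtain ⟨m, hm, rfl⟩ := mem_op_smul_subgroup.1 hx
  obtain ⟨m', hm', he⟩ := mem_op_smul_subgroup.1 hx'
  have hB'' : B' = m'⁻¹ * m * B := by rw [mul_assoc, ← he, inv_mul_cancel_left]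
  rw [hB'']
  exact (h _ (M.mul_mem (M.inv_mem hm') hm) B hB (hB'' ▸ hB')).symm

theorem pairwiseDisjoint_Cas :
    Base.PairwiseDisjoint fun B => MulOpposite.op B • (Cas : Set Unimod) :=
  pairwiseDisjoint_op_smul fun c hc B hB h => by
    rw [eq_one_of_Cas_mul_mem_Base hc hB h, one_mul]

theorem pairwiseDisjoint_Sca :
    NormBase.PairwiseDisjoint fun B => MulOpposite.op B • (Sca : Set Unimod) := by
  refine pairwiseDisjoint_op_smul fun s hs B hB h => ?_
  obtain ⟨c, hc, _, ⟨K, rfl⟩, rfl⟩ := exists_mul_of_mem_Sca hs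
  rw [mul_assoc] at h ⊢
  have hc1 := eq_one_of_Cas_mul_mem_Base hc (gain_mul_mem_Base K hB.1) h.1
  rw [hc1, one_mul] at h ⊢
  have hK := h.2
  rw [eval_filt_gain_mul, hB.2, mul_one, inv_eq_one] at hK
  rw [Units.val_eq_one.1 hK, map_one, one_mul]

/-! ### Failure for left cosets -/

theorem haar_mul_notMem_HS : haar * upsilon (.ofAdd (antiBinom 1 1)) ∉ HS := by
  intro h
  have h1 := (mem_HS_iff.1 h).1
  have h00 : (haar * upsilon (.ofAdd (antiBinom 1 1))).1 0 0 = LaurentPolynomial.C (1 / 2) := by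
    change (haar.1 * !![1, antiBinom 1 1; 0, 1]) 0 0 = _
    simp [Matrix.mul_apply, haar]
  have h01 : (haar * upsilon (.ofAdd (antiBinom 1 1))).1 0 1 =
      LaurentPolynomial.C (1 / 2) * antiBinom 1 1 + LaurentPolynomial.C (1 / 2) := by
    change (haar.1 * !![1, antiBinom 1 1; 0, 1]) 0 1 = _
    simp [Matrix.mul_apply, haar]
  rw [h00, h01, LaurentPolynomial.invert_C, right_eq_add, ← LaurentPolynomial.smul_eq_C_mul] at h1
  have h2 := congrArg (fun f : ℝ[T;T⁻¹] => f.coeff 1) h1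
  simp only [AddMonoidAlgebra.coeff_smul_apply, coeff_antiBinom_self 1 one_pos] at h2
  norm_num at h2

/-- A union of left cosets of `M` is stable under right multiplication by `M`, and the Haar bank
violates this. -/
theorem not_iUnion_leftCosets {M : Subgroup Unimod} (hM : Cas ≤ M) :
    ¬ ∃ X : Set Unimod, HS = ⋃ A ∈ X, A • (M : Set Unimod) := by
  rintro ⟨X, hX⟩
  have hh := haar_mem_HS
  rw [hX] at hh
  simp only [Set.mem_iUnion, exists_prop] at hh
  obtain ⟨A, hA, m, hm, hmA⟩ := hh
  apply haar_mul_notMem_HS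
  rw [hX]
  simp only [Set.mem_iUnion, exists_prop]
  refine ⟨A, hA, m * upsilon (.ofAdd (antiBinom 1 1)),
    M.mul_mem hm (hM (upsilon_mem_Cas (antiBinom_mem_WA 1 1))), ?_⟩
  rw [← hmA]
  exact (mul_assoc _ _ _).symm

end HSBank

end

open HSBank in
theorem mainTheorem5 :
    -- `𝒮 ≅ 𝒟 ⋉_θ (𝒰 ∗ ℒ)` via `d c ↦ (d, ρ c)`, where `ρ : 𝒞 ≅ 𝒰 ∗ ℒ` fixes the letters
    -- and `θ_d = ρ ∘ γ_d ∘ ρ⁻¹`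
    (∃ (ρ : Cas ≃* Monoid.Coprod U L)
        (ψ : Sca ≃* SemidirectProduct (Monoid.Coprod U L) D theta),
      (∀ u : U, ρ (Subgroup.inclusion U_le_Cas u) = Monoid.Coprod.inl u) ∧
      (∀ l : L, ρ (Subgroup.inclusion L_le_Cas l) = Monoid.Coprod.inr l) ∧
      (∀ (d : D) (c : Cas), theta d (ρ c) = ρ (gamma Cas D_le_normalizer_Cas d c)) ∧
      (∀ (d : D) (c : Cas),
        ψ (Subgroup.inclusion D_le_Sca d * Subgroup.inclusion Cas_le_Sca c) =
          SemidirectProduct.inr d * SemidirectProduct.inl (ρ c))) ∧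
    -- partition into right cosets `𝒞 B`
    (HS = ⋃ B ∈ Base, MulOpposite.op B • (Cas : Set Unimod)) ∧
    (Base.PairwiseDisjoint fun B => MulOpposite.op B • (Cas : Set Unimod)) ∧
    -- partition into right cosets `𝒮 B`
    (HS = ⋃ B ∈ NormBase, MulOpposite.op B • (Sca : Set Unimod)) ∧
    (NormBase.PairwiseDisjoint fun B => MulOpposite.op B • (Sca : Set Unimod)) ∧
    -- no representation as a union of left cosets
    (¬ ∃ X : Set Unimod, HS = ⋃ A ∈ X, A • (Cas : Set Unimod)) ∧
    (¬ ∃ X : Set Unimod, HS = ⋃ A ∈ X, A • (Sca : Set Unimod)) := by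
  refine ⟨⟨casEquiv, scaEquiv, fun u => casEquiv_casOfCoprod (Monoid.Coprod.inl u),
    fun l => casEquiv_casOfCoprod (Monoid.Coprod.inr l), fun d c => ?_, scaEquiv_mul⟩,
    HS_eq_iUnion_Cas, pairwiseDisjoint_Cas, HS_eq_iUnion_Sca, pairwiseDisjoint_Sca,
    not_iUnion_leftCosets le_rfl, not_iUnion_leftCosets Cas_le_Sca⟩
  rw [← casEquiv_casOfCoprod (theta d (casEquiv c)), casOfCoprod_theta, casOfCoprod_casEquiv]
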